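/- Let $k$ be an algebraically closed field of characteristic $p>3$, and let $W_1=\mathrm{Der}_k\big(k[X]/(X^p)\big)$ be the Witt algebra, a restricted Lie algebra whose $[p]$-mapping is the $p$-th power of derivations. Let $\mathcal N=\{x\in W_1\mid x^{[p]}=0\}$ be its nilpotent variety and $\mathcal C(\mathcal N)=\{(x,y)\in\mathcal N\times\mathcal N\mid [x,y]=0\}$ its nilpotent commuting variety, a Zariski closed subset of the affine space $W_1\times W_1$. Then the variety $\mathcal C(\mathcal N)$ is not normal, i.e. not all of its local rings at points are integrally closed domains. Moreover, $\mathcal C(\mathcal N)$ has at least two distinct irreducible components, and all of its irreducible components contain the point $(0,0)$. -/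

import Mathlib

open Polynomial

noncomputable section

namespace WittAlgebra

/-! ### Affine algebraic sets in a finite-dimensional vector space -/

section AffineVariety

variable (k : Type*) [Field k] {V : Type*} [AddCommGroup V] [Module k V]

variable (V) in
/-- The algebra of polynomial functions on `V`: the algebra of functions generated by the linear
forms, i.e. by the coordinates with respect to any basis. -/
def polyFunctions : Subalgebra k (V → k) :=
  Algebra.adjoin k (Set.range fun φ : Module.Dual k V => (φ : V → k))

variable (V) in
/-- The Zariski topology on `V`: the sets where a given polynomial function does not vanish
form a basis of open sets. -/
@[reducible]
def zariskiTopology : TopologicalSpace V :=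
  TopologicalSpace.generateFrom
    {U : Set V | ∃ f ∈ polyFunctions k V, U = {v | f v ≠ 0}}

/-- The irreducible components of a subset `Z` of `V`: its maximal irreducible subsets, for the
Zariski topology. -/
def zariskiComponents (Z : Set V) : Set (Set V) :=
  {T | Maximal (fun S : Set V => S ⊆ Z ∧ @IsIrreducible V (zariskiTopology k V) S) T}

/-- Restriction of functions from `V` to `Z`. -/
def restrictFunctions (Z : Set V) : (V → k) →ₐ[k] (Z → k) :=
  AlgHom.pi fun z : Z => Pi.evalAlgHom k (fun _ : V => k) (z : V)

/-- The coordinate ring `k[Z]` of an affine algebraic set `Z ⊆ V` (as a variety, i.e. reduced):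
the restrictions to `Z` of the polynomial functions on `V`. -/
def coordinateRing (Z : Set V) : Subalgebra k (Z → k) :=
  (polyFunctions k V).map (restrictFunctions k Z)

/-- Evaluation of regular functions at a point of `Z`. -/
def evalAt (Z : Set V) (z : Z) : coordinateRing k Z →+* k :=
  ((Pi.evalAlgHom k (fun _ : Z => k) z).comp (coordinateRing k Z).val).toRingHom

/-- The functions vanishing at a point form a prime (indeed maximal) ideal. -/
instance (Z : Set V) (z : Z) : (RingHom.ker (evalAt k Z z)).IsPrime :=
  RingHom.ker_isPrime _

/-- The local ring of the variety `Z` at the point `z`: the localization of `k[Z]` at the maximal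
ideal of the functions vanishing at `z`. -/
abbrev LocalRingAt (Z : Set V) (z : Z) : Type _ :=
  Localization.AtPrime (RingHom.ker (evalAt k Z z))

/-- The affine variety `Z` is normal: at each of its points, the local ring is an integrally
closed domain. -/
def IsNormalVariety (Z : Set V) : Prop :=
  ∀ z : Z, IsDomain (LocalRingAt k Z z) ∧ IsIntegrallyClosed (LocalRingAt k Z z)

end AffineVariety

/-! ### The `p`-th power of a derivation in characteristic `p` -/

section PMap

variable {k : Type*} [CommRing k] {A : Type*} [CommRing A] [Algebra k A]

/-- The higher Leibniz rule. -/
theorem derivation_pow_mul (D : Derivation k A A) (n : ℕ) (a b : A) :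
    ((D : Module.End k A) ^ n) (a * b) = ∑ ij ∈ Finset.HasAntidiagonal.antidiagonal n,
      n.choose ij.1 • (((D : Module.End k A) ^ ij.1) a * ((D : Module.End k A) ^ ij.2) b) := by
  induction n with
  | zero => simp
  | succ n ih =>
    rw [Finset.sum_antidiagonal_choose_succ_nsmul
      (fun i j => ((D : Module.End k A) ^ i) a * ((D : Module.End k A) ^ j) b) n]
    simp only [pow_succ' (D : Module.End k A), Module.End.mul_apply, ih, map_sum, map_nsmul,
      Derivation.coeFn_coe, Derivation.leibniz, smul_eq_mul, smul_add, Finset.sum_add_distrib,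
      add_right_inj]
    refine Finset.sum_congr rfl fun ⟨i, j⟩ hij => ?_
    rw [n.choose_symm_of_eq_add (Finset.HasAntidiagonal.mem_antidiagonal.1 hij).symm, mul_comm]

/-- In characteristic `p`, the `p`-th power of a derivation satisfies the Leibniz rule. -/
theorem derivation_pow_char_mul (p : ℕ) [hp : Fact p.Prime] [CharP k p] (D : Derivation k A A)
    (a b : A) : ((D : Module.End k A) ^ p) (a * b) =
      a • ((D : Module.End k A) ^ p) b + b • ((D : Module.End k A) ^ p) a := by
  have hz : ∀ x : A, p • x = 0 := fun x => by
    rw [← Nat.cast_smul_eq_nsmul k, CharP.cast_eq_zero, zero_smul]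
  rw [derivation_pow_mul, Finset.Nat.sum_antidiagonal_eq_sum_range_succ_mk,
    Finset.sum_range_succ, ← Finset.sum_erase_add _ _ (Finset.mem_range.2 hp.out.pos),
    Finset.sum_eq_zero]
  · simp [mul_comm b]
  · intro i hi
    obtain ⟨c, hc⟩ := hp.out.dvd_choose_self (Finset.mem_erase.1 hi).1
      (Finset.mem_range.1 (Finset.mem_erase.1 hi).2)
    simp only [hc, mul_smul, hz]

/-- The `[p]`-mapping on the derivations of an algebra of characteristic `p`: the `p`-th power
of a derivation (as a linear endomorphism) is again a derivation. -/
def pMap (p : ℕ) [Fact p.Prime] [CharP k p] (D : Derivation k A A) : Derivation k A A :=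
  Derivation.mk' ((D : Module.End k A) ^ p) (derivation_pow_char_mul p D)

end PMap

/-! ### The Witt algebra and its nilpotent commuting variety -/

section Witt

variable (k : Type*) [Field k] (p : ℕ)

/-- The truncated polynomial algebra `k[X] / (X ^ p)`. -/
abbrev TruncatedPolynomial : Type _ :=
  k[X] ⧸ Ideal.span {(X : k[X]) ^ p}

/-- The Witt algebra `W₁`: the Lie algebra of `k`-linear derivations of `k[X] / (X ^ p)`. -/
abbrev W₁ : Type _ :=
  Derivation k (TruncatedPolynomial k p) (TruncatedPolynomial k p)

variable [Fact p.Prime] [CharP k p]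

/-- The nilpotent variety `𝒩` of `W₁`: the elements `x` with `x ^ [p] = 0`. -/
def nilpotentVariety : Set (W₁ k p) :=
  {x | pMap p x = 0}

/-- The nilpotent commuting variety of `W₁`: the pairs of commuting elements of `𝒩`. -/
def nilpotentCommutingVariety : Set (W₁ k p × W₁ k p) :=
  {xy | xy.1 ∈ nilpotentVariety k p ∧ xy.2 ∈ nilpotentVariety k p ∧ ⁅xy.1, xy.2⁆ = 0}

end Witt

end WittAlgebra

end

open Polynomial Topology

noncomputable section

namespace WittAlgebra

/-! ### Cones in the Zariski topology. -/

section AffineCone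

variable {k : Type*} [Field k] {V : Type*} [AddCommGroup V] [Module k V]

/-! An element of `W₁` with nonzero constant coefficient commutes only with its own multiples. On a
commuting pair `(D, E)`, therefore, either the `∂`-coefficient of `D` vanishes or all 2×2 minors of
the coordinates of `(D, E)` do. The product of that coefficient with the minor at `X ^ (p - 1) ∂`,
`X ^ (p - 2) ∂` thus vanishes on the variety, while neither factor does: `(∂, 0)` and `(X ^ (p - 1)
∂, X ^ (p - 2) ∂)` witness this. Hence there are two components. The variety is a cone, so every
component contains the origin, and a function that is not identically zero on it stays nonzero in
the local ring there. That ring has zero divisors, so the variety is not normal. -/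

theorem dual_mem_polyFunctions (φ : Module.Dual k V) : (φ : V → k) ∈ polyFunctions k V :=
  Algebra.subset_adjoin ⟨φ, rfl⟩

/-- A polynomial function composed with a homothety is a polynomial function. -/
theorem polyFunctions_comp_smul {f : V → k} (hf : f ∈ polyFunctions k V) (t : k) :
    (fun v => f (t • v)) ∈ polyFunctions k V := by
  induction hf using Algebra.adjoin_induction with
  | mem f h =>
    obtain ⟨φ, rfl⟩ := h
    convert dual_mem_polyFunctions (t • φ) using 1
    ext v
    simp
  | algebraMap r => exact (polyFunctions k V).algebraMap_mem r
  | add f g _ _ hf hg => exact add_mem hf hg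
  | mul f g _ _ hf hg => exact mul_mem hf hg

/-- A polynomial function restricted to a line through the origin is a polynomial. -/
theorem exists_polynomial_eval_eq {f : V → k} (hf : f ∈ polyFunctions k V) (v : V) :
    ∃ q : k[X], ∀ t, q.eval t = f (t • v) := by
  induction hf using Algebra.adjoin_induction with
  | mem f h =>
    obtain ⟨φ, rfl⟩ := h
    exact ⟨X * C (φ v), fun t => by simp only [eval_mul, eval_X, eval_C, map_smul, smul_eq_mul]⟩
  | algebraMap r => exact ⟨C r, fun t => by simp⟩
  | add f g _ _ hf hg =>
    obtain ⟨q, hq⟩ := hf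
    obtain ⟨r, hr⟩ := hg
    exact ⟨q + r, fun t => by simp [hq, hr]⟩
  | mul f g _ _ hf hg =>
    obtain ⟨q, hq⟩ := hf
    obtain ⟨r, hr⟩ := hg
    exact ⟨q * r, fun t => by simp [hq, hr]⟩

theorem isOpen_zariski_ne_zero {f : V → k} (hf : f ∈ polyFunctions k V) :
    IsOpen[zariskiTopology k V] {v | f v ≠ 0} :=
  TopologicalSpace.isOpen_generateFrom_of_mem ⟨f, hf, rfl⟩

theorem isOpen_zariski_preimage_smul {U : Set V} (hU : IsOpen[zariskiTopology k V] U) (t : k) :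
    IsOpen[zariskiTopology k V] {v | t • v ∈ U} := by
  let := zariskiTopology k V
  have h : Continuous fun v : V => t • v := by
    refine continuous_generateFrom_iff.2 ?_
    rintro _ ⟨f, hf, rfl⟩
    exact isOpen_zariski_ne_zero (polyFunctions_comp_smul hf t)
  exact hU.preimage h

/-- A Zariski open set meets a line through the origin in the empty set or a cofinite set. -/
theorem finite_smul_notMem_of_isOpen {U : Set V} (hU : IsOpen[zariskiTopology k V] U) (v : V)
    {s : k} (hs : s • v ∈ U) : {t : k | t • v ∉ U}.Finite := by
  induction hU generalizing s with
  | basic U h =>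
    obtain ⟨f, hf, rfl⟩ := h
    obtain ⟨q, hq⟩ := exists_polynomial_eval_eq hf v
    have hq0 : q ≠ 0 := by
      rintro rfl
      exact hs (by rw [← hq]; simp)
    refine (q.rootSet_finite k).subset fun t ht => ?_
    rw [mem_rootSet]
    exact ⟨hq0, by simpa [hq] using ht⟩
  | univ => simp
  | inter U U' _ _ h h' =>
    refine ((h hs.1).union (h' hs.2)).subset fun t ht => ?_
    by_contra hc
    simp only [Set.mem_union, Set.mem_ofPred_eq, not_or, not_not] at hc
    exact ht hc
  | sUnion S _ h =>
    obtain ⟨U, hUS, hU⟩ := hs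
    exact (h U hUS hU).subset fun t ht h' => ht ⟨U, hUS, h'⟩

/-- The cone over an irreducible set is irreducible. -/
theorem isIrreducible_cone [Infinite k] {T : Set V}
    (hT : @IsIrreducible V (zariskiTopology k V) T) :
    @IsIrreducible V (zariskiTopology k V) {w | ∃ t : k, ∃ v ∈ T, t • v = w} := by
  let := zariskiTopology k V
  refine ⟨?_, ?_⟩
  · obtain ⟨v, hv⟩ := hT.1
    exact ⟨v, 1, v, hv, one_smul k v⟩
  · rintro U U' hU hU' ⟨_, ⟨t, v, hv, rfl⟩, htv⟩ ⟨_, ⟨t', v', hv', rfl⟩, htv'⟩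
    -- The line through `w` meets both `U` and `U'`, hence each in a cofinite set.
    obtain ⟨w, hw, hwU, hwU'⟩ := hT.2 _ _ (isOpen_zariski_preimage_smul hU t)
      (isOpen_zariski_preimage_smul hU' t') ⟨v, hv, htv⟩ ⟨v', hv', htv'⟩
    obtain ⟨s, hs⟩ := ((finite_smul_notMem_of_isOpen hU w hwU).union
      (finite_smul_notMem_of_isOpen hU' w hwU')).exists_notMem
    simp only [Set.mem_union, Set.mem_ofPred_eq, not_or, not_not] at hs
    exact ⟨s • w, ⟨s, w, hw, rfl⟩, hs⟩

/-- The irreducible components of a cone contain the origin. -/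
theorem zero_mem_of_mem_zariskiComponents [Infinite k] {Z : Set V}
    (hZ : ∀ (t : k), ∀ v ∈ Z, t • v ∈ Z) {T : Set V} (hT : T ∈ zariskiComponents k Z) :
    (0 : V) ∈ T := by
  obtain ⟨⟨hTZ, hirr⟩, hmax⟩ := hT
  obtain ⟨v, hv⟩ := hirr.1
  -- The cone over `T` is irreducible, lies in `Z` and contains `T`, so maximality puts it inside
  -- `T`.
  refine hmax ⟨?_, isIrreducible_cone hirr⟩ (fun w hw => ⟨1, w, hw, one_smul k w⟩)
    ⟨0, v, hv, zero_smul k v⟩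
  rintro _ ⟨t, w, hw, rfl⟩
  exact hZ t w (hTZ hw)

/-- Every point of `Z` lies on an irreducible component. -/
theorem exists_mem_zariskiComponents {Z : Set V} {z : V} (hz : z ∈ Z) :
    ∃ T ∈ zariskiComponents k Z, z ∈ T := by
  let := zariskiTopology k V
  obtain ⟨T, hzT, hT⟩ := zorn_subset_nonempty {S : Set V | S ⊆ Z ∧ IsIrreducible S} (by
    intro c hc hcc hne
    refine ⟨⋃₀ c, ⟨Set.sUnion_subset fun s hs => (hc hs).1, ?_, ?_⟩,
      fun s hs => Set.subset_sUnion_of_mem hs⟩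
    · obtain ⟨s, hs⟩ := hne
      exact (hc hs).2.1.mono (Set.subset_sUnion_of_mem hs)
    · rintro U U' hU hU' ⟨x, ⟨s, hs, hxs⟩, hx⟩ ⟨x', ⟨s', hs', hxs'⟩, hx'⟩
      obtain ⟨r, hr, hsr, hsr'⟩ := hcc.directedOn s hs s' hs'
      obtain ⟨y, hy, hyU⟩ := (hc hr).2.2 U U' hU hU' ⟨x, hsr hxs, hx⟩ ⟨x', hsr' hxs', hx'⟩
      exact ⟨y, ⟨r, hr, hy⟩, hyU⟩) {z}
    ⟨Set.singleton_subset_iff.2 hz, isIrreducible_singleton⟩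
  exact ⟨T, hT, hzT rfl⟩

/-- Two polynomial functions with product zero, neither of them zero on `Z`, separate irreducible
components of `Z`. -/
theorem zariskiComponents_nontrivial {Z : Set V} {f g : V → k} (hf : f ∈ polyFunctions k V)
    (hg : g ∈ polyFunctions k V) (hfg : ∀ z ∈ Z, f z * g z = 0) {z z' : V} (hz : z ∈ Z)
    (hz' : z' ∈ Z) (hfz : f z ≠ 0) (hgz : g z' ≠ 0) : (zariskiComponents k Z).Nontrivial := by
  obtain ⟨T, hT, hzT⟩ := exists_mem_zariskiComponents (k := k) hz
  obtain ⟨T', hT', hzT'⟩ := exists_mem_zariskiComponents (k := k) hz'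
  refine ⟨T, hT, T', hT', ?_⟩
  rintro rfl
  obtain ⟨y, hy, hfy, hgy⟩ := hT.1.2.2 _ _ (isOpen_zariski_ne_zero hf) (isOpen_zariski_ne_zero hg)
    ⟨z, hzT, hfz⟩ ⟨z', hzT', hgz⟩
  exact mul_ne_zero hfy hgy (hfg y (hT.1.1 hy))

/-- On a cone, a polynomial function that does not vanish identically has nonzero image in the
local ring at the origin. -/
theorem algebraMap_localRingAt_zero_ne_zero [Infinite k] {Z : Set V}
    (hZ : ∀ (t : k), ∀ v ∈ Z, t • v ∈ Z) (h0 : (0 : V) ∈ Z) {f : V → k}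
    (hf : f ∈ polyFunctions k V) {z : V} (hz : z ∈ Z) (hfz : f z ≠ 0) :
    algebraMap (coordinateRing k Z) (LocalRingAt k Z ⟨0, h0⟩)
      ⟨restrictFunctions k Z f, f, hf, rfl⟩ ≠ 0 := by
  intro h
  rw [IsLocalization.map_eq_zero_iff
    (RingHom.ker (evalAt k Z ⟨0, h0⟩)).primeCompl] at h
  obtain ⟨⟨⟨_, e, he, rfl⟩, hm⟩, h⟩ := h
  have he0 : e 0 ≠ 0 := fun h' => hm h'
  -- On the line through `z`, `e` and `f` become polynomials with product zero; `e` is nonzero at `t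
  -- = 0` and `f` at `t = 1`.
  have hef : ∀ t : k, e (t • z) * f (t • z) = 0 := fun t =>
    congrFun (congrArg Subtype.val h) ⟨t • z, hZ t z hz⟩
  obtain ⟨q, hq⟩ := exists_polynomial_eval_eq he z
  obtain ⟨r, hr⟩ := exists_polynomial_eval_eq hf z
  have hqr : q * r = 0 := Polynomial.funext fun t => by simp [hq, hr, hef]
  rcases mul_eq_zero.1 hqr with rfl | rfl
  · exact he0 (by simpa using (hq 0).symm)
  · exact hfz (by simpa using (hr 1).symm)

/-- A cone with two polynomial functions with product zero, neither of them zero, is not normal: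
its local ring at the origin is not a domain. -/
theorem not_isNormalVariety_of_mul_eq_zero [Infinite k] {Z : Set V}
    (hZ : ∀ (t : k), ∀ v ∈ Z, t • v ∈ Z) {f g : V → k} (hf : f ∈ polyFunctions k V)
    (hg : g ∈ polyFunctions k V) (hfg : ∀ z ∈ Z, f z * g z = 0) {z z' : V} (hz : z ∈ Z)
    (hz' : z' ∈ Z) (hfz : f z ≠ 0) (hgz : g z' ≠ 0) : ¬ IsNormalVariety k Z := by
  intro hN
  have h0 : (0 : V) ∈ Z := zero_smul k z ▸ hZ 0 z hz
  have := (hN ⟨0, h0⟩).1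
  refine mul_ne_zero (algebraMap_localRingAt_zero_ne_zero hZ h0 hf hz hfz)
    (algebraMap_localRingAt_zero_ne_zero hZ h0 hg hz' hgz) ?_
  rw [← map_mul]
  convert map_zero (algebraMap (coordinateRing k Z) (LocalRingAt k Z ⟨0, h0⟩))
  ext w
  exact hfg w w.2

end AffineCone

/-! ### Centralizers and explicit elements in the Witt algebra. -/

section Derivations

theorem Derivation.lie_sub_smul_self {R A : Type*} [CommRing R] [CommRing A] [Algebra R A]
    {D E : Derivation R A A} (h : ⁅D, E⁆ = 0) (c : R) : ⁅D, E - c • D⁆ = 0 := by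
  simp [lie_sub, h]

theorem Derivation.smul_lie_smul_eq_zero {R A : Type*} [CommRing R] [CommRing A] [Algebra R A]
    {D E : Derivation R A A} (h : ⁅D, E⁆ = 0) (c : R) : ⁅c • D, c • E⁆ = 0 := by
  ext a
  have h' : D (E a) - E (D a) = 0 := by rw [← Derivation.commutator_apply, h]; rfl
  simp [Derivation.commutator_apply, ← smul_sub, h']

theorem Module.End.pow_apply_eq_zero_of_apply_apply {R M : Type*} [Semiring R] [AddCommMonoid M]
    [Module R M] {f : Module.End R M} {n : ℕ} (hn : 2 ≤ n) {x : M} (h : f (f x) = 0) :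
    (f ^ n) x = 0 := by
  rw [← pow_sub_mul_pow f hn, Module.End.mul_apply, pow_two, Module.End.mul_apply, h, map_zero]

theorem dual_sub_div_smul_eq_zero {K V : Type*} [Field K] [AddCommGroup V] [Module K V]
    (φ : Module.Dual K V) {v : V} (hv : φ v ≠ 0) (w : V) : φ (w - (φ w / φ v) • v) = 0 := by
  simp [hv]

variable {k : Type*} [Field k] {p : ℕ}

/-- The quotient map `k[X] → k[X] / (X ^ p)`. -/
def truncate (k : Type*) [Field k] (p : ℕ) : k[X] →ₐ[k] TruncatedPolynomial k p :=
  Ideal.Quotient.mkₐ k (Ideal.span {(X : k[X]) ^ p})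

theorem truncate_surjective : Function.Surjective (truncate k p) :=
  Ideal.Quotient.mkₐ_surjective k _

theorem truncate_eq_zero_iff {q : k[X]} : truncate k p q = 0 ↔ ∀ i < p, q.coeff i = 0 := by
  rw [truncate, Ideal.Quotient.mkₐ_eq_mk, Ideal.Quotient.eq_zero_iff_mem,
    Ideal.mem_span_singleton, X_pow_dvd_iff]

/-- The coefficient of `X ^ i` as a linear form on `k[X] / (X ^ p)`. -/
def truncatedCoeff (i : Fin p) : TruncatedPolynomial k p →ₗ[k] k :=
  (((Ideal.span {(X : k[X]) ^ p}).restrictScalars k).liftQ (lcoeff k i) (fun q hq => by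
    have := truncate_eq_zero_iff.1 (Ideal.Quotient.eq_zero_iff_mem.2 hq) i i.2
    simpa using this)).comp
  (Submodule.Quotient.restrictScalarsEquiv k (Ideal.span {(X : k[X]) ^ p})).symm.toLinearMap

@[simp]
theorem truncatedCoeff_truncate (i : Fin p) (q : k[X]) :
    truncatedCoeff i (truncate k p q) = q.coeff i :=
  rfl

/-- The coefficient of `X ^ i ∂` as a linear form on the Witt algebra. -/
def coord (i : Fin p) : Module.Dual k (W₁ k p) where
  toFun D := truncatedCoeff i (D (truncate k p X))
  map_add' D E := by simp
  map_smul' t D := by simp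

theorem coord_apply (i : Fin p) (D : W₁ k p) :
    coord i D = truncatedCoeff i (D (truncate k p X)) :=
  rfl

theorem aeval_truncate_X (q : k[X]) : aeval (truncate k p X) q = truncate k p q := by
  rw [aeval_algHom_apply, aeval_X_left_apply]

theorem W₁_apply_truncate (D : W₁ k p) (q : k[X]) :
    D (truncate k p q) = truncate k p (derivative q) * D (truncate k p X) := by
  have h := D.map_aeval q (truncate k p X)
  rwa [aeval_truncate_X, aeval_truncate_X] at h

theorem W₁_ext {D E : W₁ k p} (h : D (truncate k p X) = E (truncate k p X)) : D = E := by
  ext a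
  obtain ⟨q, rfl⟩ := truncate_surjective a
  rw [W₁_apply_truncate D, W₁_apply_truncate E, h]

/-- An element of the Witt algebra that commutes with one outside of the standard maximal
subalgebra is a multiple of it. -/
theorem exists_eq_smul_of_lie_eq_zero [CharP k p] (hp : 0 < p) {D E : W₁ k p} (hDE : ⁅D, E⁆ = 0)
    (hD : coord ⟨0, hp⟩ D ≠ 0) : ∃ c : k, E = c • D := by
  refine ⟨coord ⟨0, hp⟩ E / coord ⟨0, hp⟩ D, ?_⟩
  rw [← sub_eq_zero]
  -- Subtracting this multiple of `D` kills the constant coefficient; it remains to show `F = 0`.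
  set F := E - (coord ⟨0, hp⟩ E / coord ⟨0, hp⟩ D) • D
  have hDF : ⁅D, F⁆ = 0 := Derivation.lie_sub_smul_self hDE _
  have hF0 : coord ⟨0, hp⟩ F = 0 := dual_sub_div_smul_eq_zero _ hD E
  obtain ⟨q, hq⟩ := truncate_surjective (D (truncate k p X))
  obtain ⟨r, hr⟩ := truncate_surjective (F (truncate k p X))
  have hq0 : q.coeff 0 ≠ 0 := by
    rwa [coord_apply, ← hq, truncatedCoeff_truncate] at hD
  have hr0 : r.coeff 0 = 0 := by
    rwa [coord_apply, ← hr, truncatedCoeff_truncate] at hF0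
  -- This is the bracket of `q ∂` and `r ∂`.
  have hqr : truncate k p (derivative r * q - derivative q * r) = 0 := by
    have h := congrArg (fun d : W₁ k p => d (truncate k p X)) hDF
    rw [map_sub, map_mul, map_mul]
    simpa [Derivation.commutator_apply, ← hq, ← hr, W₁_apply_truncate D, W₁_apply_truncate F]
      using h
  rw [truncate_eq_zero_iff] at hqr
  refine W₁_ext ?_
  rw [← hr, Derivation.coe_zero, Pi.zero_apply, truncate_eq_zero_iff]
  intro i
  induction i using Nat.strong_induction_on with
  | _ i ih =>
    intro hi
    cases i with
    | zero => exact hr0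
    | succ n =>
      -- The lowest coefficient of the bracket, in degree `n`, is `(n + 1) * s(0) * q(0)`, and `n +
      -- 1 < p` is invertible in `k`.
      obtain ⟨s, rfl⟩ : X ^ (n + 1) ∣ r := X_pow_dvd_iff.2 fun m hm => ih m hm (hm.trans hi)
      have h := hqr n (by lia)
      have e : derivative (X ^ (n + 1) * s) * q - derivative q * (X ^ (n + 1) * s) =
          X ^ n * (C ((n + 1 : ℕ) : k) * s * q + X * (derivative s * q - derivative q * s)) := by
        simp only [derivative_mul, derivative_X_pow, Nat.add_sub_cancel]
        ring
      have hn : ((n + 1 : ℕ) : k) ≠ 0 := by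
        rw [Ne, CharP.cast_eq_zero_iff k p]
        exact fun hd => absurd (Nat.le_of_dvd n.succ_pos hd) (by lia)
      rw [e] at h
      have h' : ((n + 1 : ℕ) : k) * s.coeff 0 * q.coeff 0 = 0 := by
        simpa [coeff_X_pow_mul', mul_coeff_zero] using h
      have hs : s.coeff 0 = 0 := by
        simpa [hq0, hn, -Nat.cast_add] using h'
      simpa [coeff_X_pow_mul'] using hs

/-- In characteristic `p` the derivative of `X ^ p` is zero, so `q ∂` preserves the ideal `(X ^ p)`.
-/
theorem truncate_smul_derivative'_eq_zero [CharP k p] (q r : k[X]) (hr : truncate k p r = 0) :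
    truncate k p ((q • (derivative' : Derivation k k[X] k[X])) r) = 0 := by
  rw [truncate_eq_zero_iff, ← X_pow_dvd_iff] at hr ⊢
  obtain ⟨s, rfl⟩ := hr
  exact ⟨q * derivative s, by simp [mul_left_comm]⟩

/-- The derivation `q ∂` of `k[X] / (X ^ p)`. -/
def derivationOfPolynomial [CharP k p] (q : k[X]) : W₁ k p :=
  Derivation.liftOfSurjective (f := truncate k p) truncate_surjective
    (truncate_smul_derivative'_eq_zero q)

@[simp]
theorem derivationOfPolynomial_apply [CharP k p] (q r : k[X]) :
    derivationOfPolynomial q (truncate k p r) = truncate k p (q * derivative r) :=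
  Derivation.liftOfSurjective_apply (f := truncate k p) truncate_surjective
    (truncate_smul_derivative'_eq_zero q) r

theorem coord_derivationOfPolynomial [CharP k p] (i : Fin p) (q : k[X]) :
    coord i (derivationOfPolynomial (p := p) q) = q.coeff i := by
  simp [coord_apply]

theorem pow_dvd_X_pow_mul_derivative {m n : ℕ} (h : p + 1 ≤ m + n) :
    (X : k[X]) ^ p ∣ X ^ m * derivative (X ^ n) := by
  rw [derivative_X_pow, mul_left_comm, ← pow_add]
  exact (pow_dvd_pow X (by lia)).mul_left _

variable [Fact p.Prime] [CharP k p]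

/-- `D ^ p` is itself a derivation, so it is enough that it kills `X`. -/
theorem mem_nilpotentVariety_of_apply_apply_eq_zero (hp : 2 ≤ p) {D : W₁ k p}
    (h : D (D (truncate k p X)) = 0) : D ∈ nilpotentVariety k p := by
  refine W₁_ext ?_
  exact Module.End.pow_apply_eq_zero_of_apply_apply hp h

theorem smul_mem_nilpotentVariety (t : k) {D : W₁ k p} (h : D ∈ nilpotentVariety k p) :
    t • D ∈ nilpotentVariety k p := by
  ext a
  have h' : ((D : Module.End k (TruncatedPolynomial k p)) ^ p) a = 0 :=
    congrArg (fun d : W₁ k p => d a) h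
  change (((t • D : W₁ k p) : Module.End k (TruncatedPolynomial k p)) ^ p) a = 0
  rw [Derivation.coe_smul_linearMap, _root_.smul_pow, LinearMap.smul_apply, h',
    smul_zero]

theorem smul_mem_nilpotentCommutingVariety (t : k) (v : W₁ k p × W₁ k p)
    (hv : v ∈ nilpotentCommutingVariety k p) : t • v ∈ nilpotentCommutingVariety k p :=
  ⟨smul_mem_nilpotentVariety t hv.1, smul_mem_nilpotentVariety t hv.2.1,
    Derivation.smul_lie_smul_eq_zero hv.2.2 t⟩

theorem derivationOfPolynomial_mem_nilpotentVariety (hp : 2 ≤ p) {q : k[X]}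
    (h : X ^ p ∣ q * derivative q) : derivationOfPolynomial q ∈ nilpotentVariety k p := by
  refine mem_nilpotentVariety_of_apply_apply_eq_zero hp ?_
  rw [derivationOfPolynomial_apply, derivative_X, mul_one, derivationOfPolynomial_apply]
  exact truncate_eq_zero_iff.2 (X_pow_dvd_iff.1 h)

theorem derivationOfPolynomial_X_pow_mem (hp : 3 < p) :
    (derivationOfPolynomial (X ^ (p - 1)), derivationOfPolynomial (X ^ (p - 2))) ∈
      nilpotentCommutingVariety k p := by
  -- That `X ^ (p - 2) ∂` applied twice kills `X` needs `2 * (p - 2) ≥ p + 1`, that is `p ≥ 5`.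
  have hp4 : p ≠ 4 := by
    rintro rfl
    exact absurd (Fact.out : Nat.Prime 4) (by norm_num)
  refine ⟨derivationOfPolynomial_mem_nilpotentVariety (by lia)
      (pow_dvd_X_pow_mul_derivative (by lia)),
    derivationOfPolynomial_mem_nilpotentVariety (by lia)
      (pow_dvd_X_pow_mul_derivative (by lia)), W₁_ext ?_⟩
  have h : truncate k p (X ^ (p - 1) * derivative (X ^ (p - 2))) = 0 :=
    truncate_eq_zero_iff.2 (X_pow_dvd_iff.1 (pow_dvd_X_pow_mul_derivative (by lia)))
  have h' : truncate k p (X ^ (p - 2) * derivative (X ^ (p - 1))) = 0 :=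
    truncate_eq_zero_iff.2 (X_pow_dvd_iff.1 (pow_dvd_X_pow_mul_derivative (by lia)))
  simp only [Derivation.commutator_apply, derivationOfPolynomial_apply, derivative_X, mul_one, h,
    h', sub_zero, Derivation.coe_zero, Pi.zero_apply]

theorem derivationOfPolynomial_one_mem (hp : 2 ≤ p) :
    (derivationOfPolynomial 1, 0) ∈ nilpotentCommutingVariety k p := by
  refine ⟨derivationOfPolynomial_mem_nilpotentVariety hp (by simp), ?_,
    W₁_ext (by simp [Derivation.commutator_apply])⟩
  exact mem_nilpotentVariety_of_apply_apply_eq_zero hp (by simp)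

end Derivations

end WittAlgebra

end

open WittAlgebra in
/-- The nilpotent commuting variety of the Witt algebra `W₁` is not normal; it has at least two
irreducible components, and all its irreducible components pass through `(0, 0)`. -/
theorem corollary1 (k : Type*) [Field k] [IsAlgClosed k] (p : ℕ) [Fact p.Prime] [CharP k p]
    (hp : 3 < p) :
    ¬ WittAlgebra.IsNormalVariety k (WittAlgebra.nilpotentCommutingVariety k p) ∧
      (WittAlgebra.zariskiComponents k
        (WittAlgebra.nilpotentCommutingVariety k p)).Nontrivial ∧
      ∀ T ∈ WittAlgebra.zariskiComponents k (WittAlgebra.nilpotentCommutingVariety k p),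
        ((0, 0) : WittAlgebra.W₁ k p × WittAlgebra.W₁ k p) ∈ T := by
  have hp0 : 0 < p := by lia
  let a : Fin p := ⟨p - 1, by lia⟩
  let b : Fin p := ⟨p - 2, by lia⟩
  let x (i : Fin p) : W₁ k p × W₁ k p → k := coord i ∘ₗ LinearMap.fst k _ _
  let y (i : Fin p) : W₁ k p × W₁ k p → k := coord i ∘ₗ LinearMap.snd k _ _
  have hx (i) : x i ∈ polyFunctions k _ := dual_mem_polyFunctions _
  have hy (i) : y i ∈ polyFunctions k _ := dual_mem_polyFunctions _
  -- This minor vanishes on proportional pairs.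
  have hg : x a * y b - x b * y a ∈ polyFunctions k _ :=
    sub_mem (mul_mem (hx a) (hy b)) (mul_mem (hx b) (hy a))
  have hfg : ∀ z ∈ nilpotentCommutingVariety k p,
      x ⟨0, hp0⟩ z * (x a * y b - x b * y a) z = 0 := by
    rintro ⟨D, E⟩ ⟨-, -, hDE⟩
    by_cases hD : coord ⟨0, hp0⟩ D = 0
    · exact mul_eq_zero_of_left hD _
    · obtain ⟨c, rfl⟩ : ∃ c : k, E = c • D := exists_eq_smul_of_lie_eq_zero hp0 hDE hD
      refine mul_eq_zero_of_right _ ?_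
      change coord a D * coord b (c • D) - coord b D * coord a (c • D) = 0
      rw [map_smul, map_smul, smul_eq_mul, smul_eq_mul]
      ring
  have hz := derivationOfPolynomial_one_mem (k := k) (p := p) (by lia)
  have hz' := derivationOfPolynomial_X_pow_mem (k := k) hp
  have hfz : x ⟨0, hp0⟩ (derivationOfPolynomial 1, 0) ≠ 0 := by
    change coord (k := k) _ (derivationOfPolynomial 1) ≠ 0
    simp [coord_derivationOfPolynomial]
  have hgz : (x a * y b - x b * y a)
      (derivationOfPolynomial (X ^ (p - 1)), derivationOfPolynomial (X ^ (p - 2))) ≠ 0 := by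
    change coord a (derivationOfPolynomial (X ^ (p - 1) : k[X])) *
        coord b (derivationOfPolynomial (X ^ (p - 2) : k[X])) -
      coord b (derivationOfPolynomial (X ^ (p - 1) : k[X])) *
        coord a (derivationOfPolynomial (X ^ (p - 2) : k[X])) ≠ 0
    have h : p - 1 ≠ p - 2 := by lia
    simp [coord_derivationOfPolynomial, a, b, coeff_X_pow, h, h.symm]
  exact ⟨not_isNormalVariety_of_mul_eq_zero smul_mem_nilpotentCommutingVariety (hx _) hg hfg
      hz hz' hfz hgz,
    zariskiComponents_nontrivial (hx _) hg hfg hz hz' hfz hgz,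
    fun T hT => zero_mem_of_mem_zariskiComponents smul_mem_nilpotentCommutingVariety hT⟩
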